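/- Let $k\in\mathbb{N}$, $p\in[0,1]$ and let $G=(V,E)$ be a finite simple graph. In the $(k,p,\mathcal{B})$-Edge-Majority dynamics on $G$ every node $u\in V$ has, in each round $t\in\mathbb{N}_0$, a state in $\{\mathcal{R},\mathcal{B}\}$. In each round, synchronously, every node $u$ samples $k$ neighbours independently and uniformly at random with replacement; each sampled neighbour is seen by $u$ in state $\mathcal{B}$ with probability $p$ regardless of its actual state, and is seen in its actual current state otherwise, independently for all samples, nodes and rounds. The state of $u$ in the next round is the state in which the majority of its $k$ samples is seen; if $k$ is even, ties are broken by an independent fair coin. Let $R^{(t)}$ and $B^{(t)}$ be the sets of nodes in state $\mathcal{R}$ and $\mathcal{B}$ in round $t$, let $\mathrm{vol}(S)=\sum_{v\in S}\deg(v)$ for $S\subseteq V$, and let $\mathbf{P}_k$ be the law of the dynamics started from the configuration in which every node is in state $\mathcal{R}$. **Proposition.** Fix $p\in[0,1]$. For every $\gamma>0$ there exists $H=H(p,\gamma)$ such that for every sequence of simple graphs $(G_n)_{n\in\mathbb{N}}$, with $G_n$ on the vertex set $V_n=\{1,\dots,n\}$, satisfying $\min_{u\in V_n}\deg(u)=\omega(\log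 n)$, the following holds for the $(k,p,\mathcal{B})$-Edge-Majority dynamics on $G_n$ as $n\to\infty$. 1. (Fast disruption) If $p>\frac12$, then for every $k>H$ $$\mathbf{P}_k\left(\frac{\mathrm{vol}(B^{(1)})}{\mathrm{vol}(V_n)}\ge 1-\gamma\right)=1-o(1).$$ 2. (Slow disruption) If $p<\frac12$, then for every $k>H$ and every $K>0$ $$\mathbf{P}_k\left(\forall t\in[0,n^K],\ \frac{\mathrm{vol}(R^{(t)})}{\mathrm{vol}(V_n)}\ge 1-\gamma\right)=1-o(1).$$ -/

import Mathlib

open Filter Topology MeasureTheory Asymptotics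

noncomputable section

namespace EdgeMajority

/-- The two possible states of a node. -/
inductive Opinion where
  | R
  | B
  deriving DecidableEq

instance : Fintype Opinion :=
  ⟨{Opinion.R, Opinion.B}, fun s => by cases s <;> simp⟩

instance : Nonempty Opinion := ⟨Opinion.R⟩

instance : MeasurableSpace Opinion := ⊤

instance : DiscreteMeasurableSpace Opinion := ⟨fun _ => trivial⟩

/-- A configuration: the vector of the states of the `n` nodes. -/
abbrev Config (n : ℕ) : Type := Fin n → Opinion

/-- The configuration in which every node is in state `R`. -/
def allR (n : ℕ) : Config n := fun _ => Opinion.R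

/-- The state in which a sampled neighbour with actual state `s` is seen, where `corrupted`
tells whether the communication has been corrupted. -/
def seenAs (corrupted : Bool) (s : Opinion) : Opinion :=
  if corrupted then Opinion.B else s

/-- The randomness used by one node in one round: the `k` sampled neighbours (in the order in
which they are drawn), each with a flag telling whether its state is seen corrupted, and the
state to be adopted in case of a tie. -/
abbrev NodeNoise (n k : ℕ) : Type := (Fin k → Fin n × Bool) × Opinion

/-- The number of samples that are seen in state `s`, if `x` is the current configuration. -/
def countSeen {n k : ℕ} (x : Config n) (samples : Fin k → Fin n × Bool) (s : Opinion) : ℕ :=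
  (Finset.univ.filter fun i => seenAs (samples i).2 (x (samples i).1) = s).card

/-- The new state of a node: the majority of the states seen in the sample. -/
def newState {n k : ℕ} (x : Config n) (ν : NodeNoise n k) : Opinion :=
  if countSeen x ν.1 Opinion.B < countSeen x ν.1 Opinion.R then Opinion.R
  else if countSeen x ν.1 Opinion.R = countSeen x ν.1 Opinion.B then ν.2
  else Opinion.B

/-- The randomness of the whole process: that of every node in every round. -/
abbrev Noise (n k : ℕ) : Type := ℕ → Fin n → NodeNoise n k

/-- The configuration at each round, from the initial configuration `x₀`: all the nodes are
updated synchronously. -/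
def config {n k : ℕ} (x₀ : Config n) (ω : Noise n k) : ℕ → Config n
  | 0 => x₀
  | t + 1 => fun u => newState (config x₀ ω t) (ω t u)

/-- The law of one sampled neighbour of `u`: uniform on the neighbourhood of `u`. (An isolated
node has no neighbour to sample; by convention it samples itself.) -/
def neighborLaw {n : ℕ} (G : SimpleGraph (Fin n)) [DecidableRel G.Adj] (u : Fin n) :
    PMF (Fin n) :=
  if h : (G.neighborFinset u).Nonempty then PMF.uniformOfFinset (G.neighborFinset u) h
  else PMF.pure u

/-- The law of one corruption flag: `true` with probability `p`. -/
def biasLaw (p : unitInterval) : Measure Bool :=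
  ProbabilityTheory.bernoulliMeasure true false p

instance (p : unitInterval) : IsProbabilityMeasure (biasLaw p) := by
  unfold biasLaw
  infer_instance

/-- The law of the randomness used by `u` in one round: `k` independent samples (with
replacement) with independent corruption flags, and an independent fair coin for ties. -/
def nodeNoiseLaw (p : unitInterval) (k : ℕ) {n : ℕ} (G : SimpleGraph (Fin n))
    [DecidableRel G.Adj] (u : Fin n) : Measure (NodeNoise n k) :=
  (Measure.pi fun _ : Fin k => (neighborLaw G u).toMeasure.prod (biasLaw p)).prod
    (PMF.uniformOfFintype Opinion).toMeasure

instance (p : unitInterval) (k : ℕ) {n : ℕ} (G : SimpleGraph (Fin n))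
    [DecidableRel G.Adj] (u : Fin n) : IsProbabilityMeasure (nodeNoiseLaw p k G u) := by
  unfold nodeNoiseLaw
  infer_instance

/-- The probability measure governing the `(k, p, B)`-Edge-Majority dynamics on `G`: the
randomness is independent over all nodes and all rounds. -/
def prob (p : unitInterval) (k : ℕ) {n : ℕ} (G : SimpleGraph (Fin n)) [DecidableRel G.Adj] :
    Measure (Noise n k) :=
  Measure.infinitePi fun _ : ℕ => Measure.pi fun u : Fin n => nodeNoiseLaw p k G u

instance (p : unitInterval) (k : ℕ) {n : ℕ} (G : SimpleGraph (Fin n)) [DecidableRel G.Adj] :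
    IsProbabilityMeasure (prob p k G) := by
  unfold prob
  infer_instance

/-- The volume of a set of nodes: the sum of the degrees. -/
def vol {n : ℕ} (G : SimpleGraph (Fin n)) [DecidableRel G.Adj] (S : Finset (Fin n)) : ℕ :=
  ∑ v ∈ S, G.degree v

/-- The set of the nodes in state `s` in the configuration `x`. -/
def nodesIn {n : ℕ} (s : Opinion) (x : Config n) : Finset (Fin n) :=
  Finset.univ.filter fun v => x v = s

/-- The fraction of the total volume that is in state `s` in the configuration `x`. -/
def volFraction {n : ℕ} (G : SimpleGraph (Fin n)) [DecidableRel G.Adj] (s : Opinion)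
    (x : Config n) : ℝ :=
  (vol G (nodesIn s x) : ℝ) / (vol G Finset.univ : ℝ)

end EdgeMajority

end

/-! The argument controls every neighbourhood, not only the total volume. If at most a fraction `α`
of each neighbourhood is in state `s`, double counting of edges shows that `s` holds at most a
fraction `α` of the volume (`Sparse.vol_le`).

Suppose each sample is seen in state `s` with probability at most `r < 1/2`. By Chernoff a node
adopts `s` with probability at most `ρ ^ k`, `ρ < 1`, hence at most `α / 4` for large `k`. Given the
current configuration, nodes update independently, so a second Chernoff bound in each neighbourhood
and a union bound over nodes give failure probability `n * exp (-(α / 2) * minDegree)`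
(`pi_not_sparse_le`), which beats every power of `n` when the minimum degree is `ω(log n)`.

For `p > 1/2`, state R is seen with probability at most `1 - p` whatever the configuration, so one
round suffices. For `p < 1/2`, sparsity of B reproduces itself: B is seen with probability at most
`p + α`, still below `1/2` for small `α`. A union bound over `n ^ K` rounds concludes. -/

namespace EdgeMajority

/-- Chernoff's bound for the number of independent events that occur. -/
theorem measureReal_pi_le_card_le {ι : Type*} [Fintype ι] {E : ι → Type*} [∀ i, Finite (E i)]
    [∀ i, MeasurableSpace (E i)] [∀ i, MeasurableSingletonClass (E i)]
    (μ : ∀ i, Measure (E i)) [∀ i, IsProbabilityMeasure (μ i)] (S : Finset ι)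
    (A : ∀ i, Set (E i)) {q θ : ℝ} (hθ : 1 ≤ θ) (hA : ∀ i ∈ S, (μ i).real (A i) ≤ q) (a : ℝ) :
    (Measure.pi μ).real {ω | ∃ T : Finset ι, T ⊆ S ∧ (∀ i ∈ T, ω i ∈ A i) ∧ a ≤ (T.card : ℝ)} ≤
      (1 + (θ - 1) * q) ^ S.card / θ ^ a := by
  classical
  have hθ0 : 0 < θ := by linarith
  -- On `S` this is `θ` raised to the indicator of `A i`, so the product over `i` is the exponential
  -- moment to which Markov's inequality is applied.
  let f : ∀ i, E i → ℝ := fun i x => if i ∈ S then 1 + (θ - 1) * (A i).indicator 1 x else 1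
  have hf1 : ∀ i x, 1 ≤ f i x := by
    intro i x
    simp only [f]
    split_ifs
    · have : 0 ≤ (A i).indicator (1 : E i → ℝ) x := Set.indicator_nonneg (by simp) x
      nlinarith
    · rfl
  have hint : ∫ ω, ∏ i, f i (ω i) ∂Measure.pi μ ≤ (1 + (θ - 1) * q) ^ S.card := by
    rw [integral_fintype_prod_eq_prod]
    have : ∀ i, ∫ x, f i x ∂μ i = if i ∈ S then 1 + (θ - 1) * (μ i).real (A i) else 1 := by
      intro i
      simp only [f]
      split_ifs
      · rw [integral_add (by simp) (Integrable.of_finite), integral_const_mul,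
          integral_indicator_one (Set.toFinite _).measurableSet]
        simp
      · simp
    simp_rw [this]
    rw [Finset.prod_ite_mem, Finset.univ_inter, ← Finset.prod_const]
    refine Finset.prod_le_prod (fun i _ => ?_) fun i hi => ?_
    · have : 0 ≤ (μ i).real (A i) := measureReal_nonneg
      nlinarith
    · have := hA i hi
      nlinarith
  have hsub : {ω : ∀ i, E i | ∃ T : Finset ι, T ⊆ S ∧ (∀ i ∈ T, ω i ∈ A i) ∧ a ≤ (T.card : ℝ)} ⊆
      {ω : ∀ i, E i | θ ^ a ≤ ∏ i, f i (ω i)} := by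
    rintro ω ⟨T, hTS, hTA, ha⟩
    change θ ^ a ≤ ∏ i, f i (ω i)
    calc θ ^ a ≤ θ ^ (T.card : ℝ) := Real.rpow_le_rpow_of_exponent_le hθ ha
      _ = ∏ i ∈ T, f i (ω i) := by
        rw [Real.rpow_natCast, ← Finset.prod_const]
        refine Finset.prod_congr rfl fun i hi => ?_
        simp [f, hTS hi, hTA i hi]
      _ ≤ ∏ i, f i (ω i) :=
        Finset.prod_le_prod_of_subset_of_one_le (Finset.subset_univ _)
          (fun i _ => zero_le_one.trans (hf1 i _)) fun i _ _ => hf1 i _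
  have hmarkov := mul_meas_ge_le_integral_of_nonneg (μ := Measure.pi μ)
    (f := fun ω => ∏ i, f i (ω i))
    (ae_of_all _ fun ω => Finset.prod_nonneg fun i _ => zero_le_one.trans (hf1 i _))
    Integrable.of_finite (θ ^ a)
  rw [le_div_iff₀ (Real.rpow_pos_of_pos hθ0 a)]
  have := measureReal_mono (μ := Measure.pi μ) hsub
  have h0 := Real.rpow_pos_of_pos hθ0 a
  nlinarith

/-! ### Majority counts, sparse states and volumes -/

variable {n : ℕ}

/-- At most the fraction `α` of the neighbours of every node is in state `s`. -/
def Sparse (G : SimpleGraph (Fin n)) [DecidableRel G.Adj] (s : Opinion) (α : ℝ)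
    (x : Config n) : Prop :=
  ∀ u, ((G.neighborFinset u ∩ nodesIn s x).card : ℝ) ≤ α * G.degree u

theorem countSeen_R_add_countSeen_B {k : ℕ} (x : Config n) (y : Fin k → Fin n × Bool) :
    countSeen x y Opinion.R + countSeen x y Opinion.B = k := by
  have h := Finset.card_filter_add_card_filter_not (s := (Finset.univ : Finset (Fin k)))
    fun i => seenAs (y i).2 (x (y i).1) = Opinion.R
  rw [Finset.card_univ, Fintype.card_fin] at h
  refine Eq.trans ?_ h
  unfold countSeen
  congr 2
  ext i
  simp only [Finset.mem_filter, Finset.mem_univ, true_and]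
  cases seenAs (y i).2 (x (y i).1) <;> simp

/-- Ties are conceded to either state, so the tie-breaking coin can be dropped from all later
estimates. -/
theorem le_two_mul_countSeen_newState {k : ℕ} (x : Config n) (ν : NodeNoise n k) :
    k ≤ 2 * countSeen x ν.1 (newState x ν) := by
  have h := countSeen_R_add_countSeen_B x ν.1
  unfold newState
  split_ifs with h1 h2
  · omega
  · cases ν.2 <;> omega
  · omega

theorem vol_nodesIn_R_add_vol_nodesIn_B (G : SimpleGraph (Fin n)) [DecidableRel G.Adj]
    (x : Config n) :
    vol G (nodesIn Opinion.R x) + vol G (nodesIn Opinion.B x) = vol G Finset.univ := by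
  have h := Finset.sum_filter_add_sum_filter_not (Finset.univ : Finset (Fin n))
    (fun v => x v = Opinion.R) fun v => G.degree v
  unfold vol nodesIn
  rw [← h]
  congr 2
  ext v
  simp only [Finset.mem_filter, Finset.mem_univ, true_and]
  cases x v <;> simp

theorem vol_eq_sum_card_inter (G : SimpleGraph (Fin n)) [DecidableRel G.Adj]
    (S : Finset (Fin n)) : vol G S = ∑ u, (G.neighborFinset u ∩ S).card := by
  have h := Finset.sum_card_bipartiteAbove_eq_sum_card_bipartiteBelow (s := S)
    (t := (Finset.univ : Finset (Fin n))) G.Adj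
  unfold vol
  convert h using 2 with v _ u _
  · rw [← SimpleGraph.card_neighborFinset_eq_degree]
    congr 1
    ext w
    simp [Finset.bipartiteAbove]
  · congr 1
    ext w
    simp [Finset.bipartiteBelow, and_comm, G.adj_comm]

theorem Sparse.vol_le {G : SimpleGraph (Fin n)} [DecidableRel G.Adj] {s : Opinion} {α : ℝ}
    {x : Config n} (h : Sparse G s α x) :
    (vol G (nodesIn s x) : ℝ) ≤ α * vol G Finset.univ := by
  rw [vol_eq_sum_card_inter, vol]
  push_cast
  rw [Finset.mul_sum]
  exact Finset.sum_le_sum fun u _ => h u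

theorem one_sub_le_volFraction {G : SimpleGraph (Fin n)} [DecidableRel G.Adj] {s s' : Opinion}
    (hs : s ≠ s') {α : ℝ} {x : Config n} (h : Sparse G s α x) (hG : 0 < vol G Finset.univ) :
    1 - α ≤ volFraction G s' x := by
  have h1 := h.vol_le
  have h2 : (vol G (nodesIn s x) : ℝ) + vol G (nodesIn s' x) = vol G Finset.univ := by
    rw [← vol_nodesIn_R_add_vol_nodesIn_B G x]
    cases s <;> cases s' <;> simp_all [add_comm]
  have hG' : (0 : ℝ) < vol G Finset.univ := by exact_mod_cast hG
  rw [volFraction, le_div_iff₀ hG']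
  linarith

/-! ### Probability bounds for one round -/

theorem sampleLaw_seenAs_R_le (p : unitInterval) (P : Measure (Fin n)) [IsProbabilityMeasure P]
    (x : Config n) :
    (P.prod (biasLaw p)).real {z | seenAs z.2 (x z.1) = Opinion.R} ≤ 1 - p := by
  have hsub : {z : Fin n × Bool | seenAs z.2 (x z.1) = Opinion.R} ⊆ Set.univ ×ˢ {false} := by
    rintro ⟨v, b⟩ h
    cases b <;> simp_all [seenAs]
  refine (measureReal_mono hsub).trans ?_
  rw [measureReal_prod_prod]
  simp [biasLaw]

/-- Union bound: either the communication is corrupted or the sampled node is itself in state B. -/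
theorem sampleLaw_seenAs_B_le (p : unitInterval) (P : Measure (Fin n)) [IsProbabilityMeasure P]
    (x : Config n) :
    (P.prod (biasLaw p)).real {z | seenAs z.2 (x z.1) = Opinion.B} ≤
      p + P.real (nodesIn Opinion.B x) := by
  have hsub : {z : Fin n × Bool | seenAs z.2 (x z.1) = Opinion.B} ⊆
      Set.univ ×ˢ {true} ∪ (nodesIn Opinion.B x : Set (Fin n)) ×ˢ Set.univ := by
    rintro ⟨v, b⟩ h
    cases b <;> simp_all [seenAs, nodesIn]
  refine (measureReal_mono hsub).trans ((measureReal_union_le _ _).trans ?_)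
  rw [measureReal_prod_prod, measureReal_prod_prod]
  simp [biasLaw]

theorem neighborLaw_real (G : SimpleGraph (Fin n)) [DecidableRel G.Adj] {u : Fin n}
    (hu : 0 < G.degree u) (S : Finset (Fin n)) :
    (neighborLaw G u).toMeasure.real S = (G.neighborFinset u ∩ S).card / (G.degree u : ℝ) := by
  have h : (G.neighborFinset u).Nonempty := by
    rwa [← Finset.card_pos, SimpleGraph.card_neighborFinset_eq_degree]
  rw [measureReal_def, neighborLaw, dif_pos h,
    PMF.toMeasure_uniformOfFinset_apply _ _ (Set.toFinite _).measurableSet]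
  simp [Finset.filter_mem_eq_inter]

theorem nodeNoiseLaw_newState_le (p : unitInterval) {k : ℕ} (G : SimpleGraph (Fin n))
    [DecidableRel G.Adj] (u : Fin n) (x : Config n) (s : Opinion) {r a : ℝ} (ha : 1 ≤ a)
    (hr : ((neighborLaw G u).toMeasure.prod (biasLaw p)).real {z | seenAs z.2 (x z.1) = s} ≤ r) :
    (nodeNoiseLaw p k G u).real {ν | newState x ν = s} ≤ ((1 + (a ^ 2 - 1) * r) / a) ^ k := by
  have ha0 : 0 < a := by linarith
  -- With `θ = a ^ 2` and threshold `k / 2` the denominator is `a ^ k`, so the whole bound is a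
  -- `k`-th power.
  have key := measureReal_pi_le_card_le
    (fun _ : Fin k => (neighborLaw G u).toMeasure.prod (biasLaw p)) Finset.univ
    (fun _ => {z | seenAs z.2 (x z.1) = s}) (θ := a ^ 2) (by nlinarith) (fun _ _ => hr) (k / 2)
  have hpow : (a ^ 2) ^ ((k : ℝ) / 2) = a ^ k := by
    rw [← Real.rpow_natCast, ← Real.rpow_mul ha0.le, ← Real.rpow_natCast]
    congr 1
    push_cast
    ring
  rw [hpow, Finset.card_univ, Fintype.card_fin, ← div_pow] at key
  refine le_trans ?_ key
  have hsub : {ν : NodeNoise n k | newState x ν = s} ⊆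
      {y | ∃ T : Finset (Fin k), T ⊆ Finset.univ ∧ (∀ i ∈ T, y i ∈
        {z : Fin n × Bool | seenAs z.2 (x z.1) = s}) ∧ (k : ℝ) / 2 ≤ T.card} ×ˢ Set.univ := by
    rintro ν rfl
    refine ⟨⟨_, Finset.filter_subset _ _, fun i hi => (Finset.mem_filter.1 hi).2, ?_⟩, trivial⟩
    have h := le_two_mul_countSeen_newState x ν
    have h' : (k : ℝ) ≤ 2 * countSeen x ν.1 (newState x ν) := by exact_mod_cast h
    rw [div_le_iff₀ two_pos, mul_comm]
    exact h'
  refine (measureReal_mono hsub).trans ?_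
  rw [nodeNoiseLaw, measureReal_prod_prod]
  simp

/-- If every node adopts state `s` with probability at most `α / 4`, then state `s` is likely to
be sparse in the next round. -/
theorem pi_not_sparse_le (G : SimpleGraph (Fin n)) [DecidableRel G.Adj] {k : ℕ}
    (μ : Fin n → Measure (NodeNoise n k)) [∀ v, IsProbabilityMeasure (μ v)]
    (x : Config n) (s : Opinion) {α : ℝ} (hα : 0 ≤ α)
    (h : ∀ v, (μ v).real {ν | newState x ν = s} ≤ α / 4) :
    (Measure.pi μ).real {η | ¬ Sparse G s α fun v => newState x (η v)} ≤
      n * Real.exp (-(α / 2 * G.minDegree)) := by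
  have hsub : {η : Fin n → NodeNoise n k | ¬ Sparse G s α fun v => newState x (η v)} ⊆
      ⋃ u, {η | ∃ T : Finset (Fin n), T ⊆ G.neighborFinset u ∧
        (∀ v ∈ T, η v ∈ {ν | newState x ν = s}) ∧ α * G.degree u ≤ T.card} := by
    intro η hη
    simp only [Sparse, Set.mem_ofPred_eq, not_forall, not_le] at hη
    obtain ⟨u, hu⟩ := hη
    refine Set.mem_iUnion.2 ⟨u, _, Finset.inter_subset_left, fun v hv => ?_, hu.le⟩
    simpa [nodesIn] using (Finset.mem_inter.1 hv).2
  refine (measureReal_mono hsub).trans ((measureReal_iUnion_fintype_le _).trans ?_)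
  calc _ ≤ ∑ _u : Fin n, Real.exp (-(α / 2 * G.minDegree)) := Finset.sum_le_sum fun u _ => ?_
    _ = _ := by simp
  refine (measureReal_pi_le_card_le μ (G.neighborFinset u) (fun _ => {ν | newState x ν = s})
    (Real.one_le_exp zero_le_one) (fun v _ => h v) _).trans ?_
  -- Chernoff with `θ = e`: since `e - 1 < 2`, each neighbour contributes a factor at most `exp (α /
  -- 2)`, against `exp (-α)` from the threshold.
  have h1 : (1 + (Real.exp 1 - 1) * (α / 4)) ≤ Real.exp (α / 2) := by
    have := Real.exp_one_lt_d9
    have := Real.add_one_le_exp (α / 2)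
    nlinarith
  have h2 : (G.minDegree : ℝ) ≤ G.degree u := by exact_mod_cast G.minDegree_le_degree u
  rw [SimpleGraph.card_neighborFinset_eq_degree, ← Real.exp_mul, one_mul,
    div_le_iff₀ (Real.exp_pos _), ← Real.exp_add]
  calc _ ≤ Real.exp (α / 2) ^ G.degree u := by
        gcongr
        have := Real.add_one_le_exp (1 : ℝ)
        nlinarith
    _ = Real.exp (G.degree u * (α / 2)) := by rw [Real.exp_nat_mul]
    _ ≤ _ := by
        apply Real.exp_le_exp.2
        nlinarith

/-! ### Independence of rounds and persistence -/

theorem config_congr {k : ℕ} (x₀ : Config n) {ω ω' : Noise n k} {t : ℕ}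
    (h : ∀ i < t, ω i = ω' i) : config x₀ ω t = config x₀ ω' t := by
  induction t with
  | zero => rfl
  | succ t ih =>
    simp only [config]
    rw [ih fun i hi => h i (hi.trans t.lt_succ_self), h t t.lt_succ_self]

/-- Factoring through finitely many rounds makes the domain of `φ` finite, so measurability is
automatic and independence from round `t` follows from that of the coordinates. -/
theorem exists_config_eq {k : ℕ} [Nonempty (Noise n k)] (x₀ : Config n) (t : ℕ) :
    ∃ φ : (Finset.range t → Fin n → NodeNoise n k) → Config n,
      ∀ ω, config x₀ ω t = φ fun i => ω i := by
  obtain ⟨ω₀⟩ := ‹Nonempty (Noise n k)›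
  refine ⟨fun y => config x₀ (fun i => if h : i ∈ Finset.range t then y ⟨i, h⟩ else ω₀ i) t,
    fun ω => config_congr x₀ fun i hi => ?_⟩
  simp [hi]

section

variable (p : unitInterval) (k : ℕ) (G : SimpleGraph (Fin n)) [DecidableRel G.Adj]

theorem measurable_config (x₀ : Config n) (t : ℕ) :
    Measurable fun ω : Noise n k => config x₀ ω t := by
  rcases isEmpty_or_nonempty (Noise n k) with h | h
  · exact measurable_of_empty _
  obtain ⟨φ, hφ⟩ := exists_config_eq (k := k) x₀ t
  simp_rw [hφ]
  have hφm : Measurable φ := fun _ _ => (Set.toFinite _).measurableSet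
  exact hφm.comp (by fun_prop)

theorem indepFun_config_noise (x₀ : Config n) (t : ℕ) :
    ProbabilityTheory.IndepFun (fun ω : Noise n k => config x₀ ω t) (fun ω => ω t)
      (prob p k G) := by
  have : Nonempty (Noise n k) := (prob p k G).nonempty_of_neZero
  obtain ⟨φ, hφ⟩ := exists_config_eq (k := k) x₀ t
  simp_rw [hφ]
  have h := (ProbabilityTheory.iIndepFun_infinitePi
    (P := fun _ : ℕ => Measure.pi fun u : Fin n => nodeNoiseLaw p k G u)
    (X := fun _ η => η) fun _ => measurable_id).indepFun_finset (Finset.range t) {t}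
    (by simp) fun i => measurable_pi_apply i
  exact h.comp (φ := φ) (ψ := fun y => y ⟨t, Finset.mem_singleton_self t⟩)
    (fun _ _ => (Set.toFinite _).measurableSet) (fun _ _ => (Set.toFinite _).measurableSet)

/-- The Markov property: split over the finitely many values of the configuration at round `t`,
which is independent of the noise used in that round. -/
theorem prob_config_succ_le (x₀ : Config n) (t : ℕ) (P Q : Config n → Prop) {δ : ℝ}
    (hδ : 0 ≤ δ)
    (h : ∀ x, P x → (Measure.pi fun u : Fin n => nodeNoiseLaw p k G u).real
      {η | ¬ Q fun u => newState x (η u)} ≤ δ) :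
    (prob p k G).real {ω | P (config x₀ ω t) ∧ ¬ Q (config x₀ ω (t + 1))} ≤ δ := by
  classical
  let A : Config n → Set (Fin n → NodeNoise n k) := fun x => {η | ¬ Q fun u => newState x (η u)}
  let C : Config n → Set (Noise n k) := fun x => (fun ω => config x₀ ω t) ⁻¹' {x}
  have hsub : {ω : Noise n k | P (config x₀ ω t) ∧ ¬ Q (config x₀ ω (t + 1))} ⊆
      ⋃ x ∈ Finset.univ.filter P, (C x ∩ (fun ω => ω t) ⁻¹' A x) := by
    rintro ω ⟨h1, h2⟩
    simp only [Set.mem_iUnion]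
    exact ⟨config x₀ ω t, by simpa using h1, rfl, h2⟩
  have hmap : ∀ B : Set (Fin n → NodeNoise n k), (prob p k G).real ((fun ω => ω t) ⁻¹' B) =
      (Measure.pi fun u : Fin n => nodeNoiseLaw p k G u).real B := by
    intro B
    have := measurePreserving_eval_infinitePi
      (fun _ : ℕ => Measure.pi fun u : Fin n => nodeNoiseLaw p k G u) t
    exact this.measureReal_preimage (Set.toFinite _).measurableSet.nullMeasurableSet
  calc _ ≤ ∑ x ∈ Finset.univ.filter P, (prob p k G).real (C x ∩ (fun ω => ω t) ⁻¹' A x) :=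
        (measureReal_mono hsub (measure_ne_top _ _)).trans (measureReal_biUnion_finset_le _ _)
    _ ≤ ∑ x ∈ Finset.univ.filter P, (prob p k G).real (C x) * δ := by
        refine Finset.sum_le_sum fun x hx => ?_
        have hind := (indepFun_config_noise p k G x₀ t).measure_inter_preimage_eq_mul {x} (A x)
          (Set.toFinite _).measurableSet (Set.toFinite _).measurableSet
        rw [measureReal_def, hind, ENNReal.toReal_mul, ← measureReal_def, ← measureReal_def, hmap]
        exact mul_le_mul_of_nonneg_left (h x (Finset.mem_filter.1 hx).2) measureReal_nonneg
    _ = (prob p k G).real ((fun ω => config x₀ ω t) ⁻¹' (Finset.univ.filter P)) * δ := by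
        rw [← Finset.sum_mul, sum_measureReal_preimage_singleton]
        exact fun x _ => measurable_config k x₀ t (Set.toFinite _).measurableSet
    _ ≤ δ := mul_le_of_le_one_left hδ measureReal_le_one

/-- A property of configurations that is unlikely to be lost in one round persists. -/
theorem prob_exists_not_le (x₀ : Config n) (T : ℕ) (P : Config n → Prop) {δ : ℝ} (hδ : 0 ≤ δ)
    (h0 : P x₀)
    (h : ∀ x, P x → (Measure.pi fun u : Fin n => nodeNoiseLaw p k G u).real
      {η | ¬ P fun u => newState x (η u)} ≤ δ) :
    (prob p k G).real {ω | ∃ t ≤ T, ¬ P (config x₀ ω t)} ≤ T * δ := by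
  -- Since `P` holds initially, a failure by round `T` forces some single round in which `P` is
  -- lost.
  have hsub : {ω : Noise n k | ∃ t ≤ T, ¬ P (config x₀ ω t)} ⊆
      ⋃ t ∈ Finset.range T, {ω | P (config x₀ ω t) ∧ ¬ P (config x₀ ω (t + 1))} := by
    rintro ω ⟨t, ht, hP⟩
    by_contra hω
    simp only [Set.mem_iUnion, not_exists, Finset.mem_range, Set.mem_ofPred_eq, not_and,
      not_not] at hω
    refine hP ?_
    clear hP
    induction t with
    | zero => exact h0
    | succ t ih => exact hω t ht (ih (by omega))
  calc _ ≤ ∑ t ∈ Finset.range T,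
        (prob p k G).real {ω | P (config x₀ ω t) ∧ ¬ P (config x₀ ω (t + 1))} :=
        (measureReal_mono hsub (measure_ne_top _ _)).trans (measureReal_biUnion_finset_le _ _)
    _ ≤ ∑ _t ∈ Finset.range T, δ :=
        Finset.sum_le_sum fun t _ => prob_config_succ_le p k G x₀ t P P hδ h
    _ = T * δ := by simp

end

/-! ### Choice of constants and asymptotics -/

theorem exists_chernoff_base_lt_one {r : ℝ} (h0 : 0 ≤ r) (h : r < 1 / 2) :
    ∃ a : ℝ, 1 ≤ a ∧ 0 ≤ (1 + (a ^ 2 - 1) * r) / a ∧ (1 + (a ^ 2 - 1) * r) / a < 1 := by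
  -- The base is below 1 iff `(a - 1) * ((a + 1) * r - 1) < 0`. Any `c` strictly between `r` and `1
  -- / 2` gives such an `a > 1` through `(a + 1) * c = 1`; the midpoint is positive even if `r = 0`.
  set c := (r + 1 / 2) / 2 with hc
  have hc0 : 0 < c := by linarith
  have ha : 1 < 1 / c - 1 := by
    rw [lt_sub_iff_add_lt, lt_div_iff₀ hc0]
    linarith
  set a := 1 / c - 1 with ha'
  have hac : (a + 1) * c = 1 := by
    rw [ha', sub_add_cancel, one_div_mul_cancel hc0.ne']
  have h1 : (a + 1) * r < 1 := by
    have : (a + 1) * r < (a + 1) * c := by gcongr; linarith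
    linarith
  refine ⟨a, ha.le, ?_, ?_⟩
  · have : 0 ≤ a ^ 2 - 1 := by nlinarith
    positivity
  · rw [div_lt_one (by linarith)]
    nlinarith

/-- If every sample is seen in state `s` with probability at most `r < 1 / 2`, then a large sample
is unlikely to have a majority of them. -/
theorem exists_nodeNoiseLaw_newState_le {r ε : ℝ} (h0 : 0 ≤ r) (h : r < 1 / 2) (hε : 0 < ε) :
    ∃ H : ℕ, ∀ k, H < k → ∀ (p : unitInterval) (n : ℕ) (G : SimpleGraph (Fin n))
      [DecidableRel G.Adj] (u : Fin n) (x : Config n) (s : Opinion),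
      ((neighborLaw G u).toMeasure.prod (biasLaw p)).real {z | seenAs z.2 (x z.1) = s} ≤ r →
      (nodeNoiseLaw p k G u).real {ν | newState x ν = s} ≤ ε := by
  obtain ⟨a, ha, hρ0, hρ1⟩ := exists_chernoff_base_lt_one h0 h
  obtain ⟨H, hH⟩ := exists_pow_lt_of_lt_one hε hρ1
  refine ⟨H, fun k hk p n G _ u x s hs => ?_⟩
  exact (nodeNoiseLaw_newState_le p G u x s ha hs).trans
    ((pow_le_pow_of_le_one hρ0 hρ1.le hk.le).trans hH.le)

/-- Subadditivity on `S n` and its complement is enough, so the events need not be shown measurable.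
-/
theorem tendsto_measure_one {Ω : ℕ → Type*} [∀ n, MeasurableSpace (Ω n)]
    (μ : ∀ n, Measure (Ω n)) [∀ n, IsProbabilityMeasure (μ n)] (S : ∀ n, Set (Ω n)) {b : ℕ → ℝ}
    (hb : Tendsto b atTop (𝓝 0)) (h : ∀ᶠ n in atTop, (μ n).real (S n)ᶜ ≤ b n) :
    Tendsto (fun n => μ n (S n)) atTop (𝓝 1) := by
  have hlim : Tendsto (fun n => (μ n).real (S n)) atTop (𝓝 1) := by
    have h1 : Tendsto (fun n => 1 - b n) atTop (𝓝 1) := by simpa using hb.const_sub 1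
    refine tendsto_of_tendsto_of_tendsto_of_le_of_le' h1 tendsto_const_nhds ?_
      (Eventually.of_forall fun n => measureReal_le_one)
    filter_upwards [h] with n hn
    have := measureReal_union_le (μ := μ n) (S n) (S n)ᶜ
    rw [Set.union_compl_self, probReal_univ] at this
    linarith
  have := ENNReal.tendsto_ofReal hlim
  simpa [measureReal_def] using this

theorem tendsto_rpow_mul_exp_neg {d : ℕ → ℝ}
    (hd : (fun n : ℕ => Real.log (n : ℝ)) =o[atTop] d) (hd0 : ∀ n, 0 ≤ d n) {K c : ℝ}
    (hK : 0 ≤ K) (hc : 0 < c) :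
    Tendsto (fun n : ℕ => (n : ℝ) ^ K * (n * Real.exp (-(c * d n)))) atTop (𝓝 0) := by
  refine squeeze_zero' (Eventually.of_forall fun n => by positivity) ?_
    tendsto_inv_atTop_nhds_zero_nat
  -- Eventually `(K + 2) * log n ≤ c * d n`, which leaves `1 / n` after the factor `n ^ (K + 1)`.
  filter_upwards [hd.bound (show 0 < c / (K + 2) by positivity), eventually_ge_atTop 1]
    with n hn hn1
  have hn0 : (0 : ℝ) < n := by exact_mod_cast hn1
  rw [Real.norm_of_nonneg (Real.log_natCast_nonneg n), Real.norm_of_nonneg (hd0 n),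
    div_mul_eq_mul_div, le_div_iff₀ (by positivity)] at hn
  calc (n : ℝ) ^ K * (n * Real.exp (-(c * d n)))
      ≤ (n : ℝ) ^ K * (n * Real.exp (-(Real.log n * (K + 2)))) := by gcongr
    _ = (n : ℝ)⁻¹ := by
      rw [Real.rpow_def_of_pos hn0]
      nth_rewrite 2 [← Real.exp_log hn0]
      rw [← Real.exp_add, ← Real.exp_add, ← Real.exp_log (inv_pos.2 hn0), Real.log_inv]
      congr 1
      ring

theorem eventually_minDegree_pos (G : ∀ n : ℕ, SimpleGraph (Fin n))
    [∀ n, DecidableRel (G n).Adj]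
    (hG : (fun n : ℕ => Real.log (n : ℝ)) =o[atTop] (fun n : ℕ => ((G n).minDegree : ℝ))) :
    ∀ᶠ n in atTop, 0 < (G n).minDegree := by
  filter_upwards [hG.bound one_pos, eventually_ge_atTop 2] with n hn hn2
  have : 0 < Real.log (n : ℝ) := Real.log_pos (by exact_mod_cast hn2)
  rw [Real.norm_of_nonneg this.le, Real.norm_of_nonneg (by positivity), one_mul] at hn
  exact_mod_cast this.trans_le hn

theorem vol_univ_pos {G : SimpleGraph (Fin n)} [DecidableRel G.Adj] (hG : 0 < G.minDegree) :
    0 < vol G Finset.univ := by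
  have hn : Nonempty (Fin n) := by
    by_contra h
    rw [not_nonempty_iff] at h
    simp at hG
  exact Finset.sum_pos (fun v _ => hG.trans_le (G.minDegree_le_degree v)) Finset.univ_nonempty

theorem sparse_allR (G : SimpleGraph (Fin n)) [DecidableRel G.Adj] {α : ℝ} (hα : 0 ≤ α) :
    Sparse G Opinion.B α (allR n) := by
  intro u
  simp only [nodesIn, allR, reduceCtorEq, Finset.filter_false, Finset.inter_empty,
    Finset.card_empty, Nat.cast_zero]
  positivity

theorem Sparse.sampleLaw_le {G : SimpleGraph (Fin n)} [DecidableRel G.Adj] {α : ℝ} {x : Config n}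
    (h : Sparse G Opinion.B α x) (p : unitInterval) {u : Fin n} (hu : 0 < G.degree u) :
    ((neighborLaw G u).toMeasure.prod (biasLaw p)).real {z | seenAs z.2 (x z.1) = Opinion.B} ≤
      p + α := by
  refine (sampleLaw_seenAs_B_le p _ x).trans ?_
  rw [neighborLaw_real G hu]
  gcongr
  rw [div_le_iff₀ (by exact_mod_cast hu)]
  exact h u

end EdgeMajority

theorem mainTheorem9 (p : unitInterval) (γ : ℝ) (hγ : 0 < γ) :
    ∃ H : ℕ, ∀ (G : ∀ n : ℕ, SimpleGraph (Fin n)) [∀ n, DecidableRel (G n).Adj],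
      (fun n : ℕ => Real.log (n : ℝ)) =o[atTop] (fun n : ℕ => ((G n).minDegree : ℝ)) →
      (1 / 2 < (p : ℝ) → ∀ k : ℕ, H < k →
        Tendsto
          (fun n : ℕ => EdgeMajority.prob p k (G n)
            {ω | 1 - γ ≤ EdgeMajority.volFraction (G n) EdgeMajority.Opinion.B
              (EdgeMajority.config (EdgeMajority.allR n) ω 1)})
          atTop (𝓝 1)) ∧
      ((p : ℝ) < 1 / 2 → ∀ k : ℕ, H < k → ∀ K : ℝ, 0 < K →
        Tendsto
          (fun n : ℕ => EdgeMajority.prob p k (G n)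
            {ω | ∀ t : ℕ, (t : ℝ) ≤ (n : ℝ) ^ K →
              1 - γ ≤ EdgeMajority.volFraction (G n) EdgeMajority.Opinion.R
                (EdgeMajority.config (EdgeMajority.allR n) ω t)})
          atTop (𝓝 1)) := by
  rcases eq_or_ne (p : ℝ) (1 / 2) with hp | hp
  · exact ⟨0, fun G _ _ => ⟨fun h => absurd hp h.ne', fun h => absurd hp h.ne⟩⟩
  obtain ⟨hp0, hp1⟩ := p.2
  set δ := |(p : ℝ) - 1 / 2| with hδ
  have hδ0 : 0 < δ := abs_pos.2 (sub_ne_zero.2 hp)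
  have hδ1 : δ ≤ 1 / 2 := abs_le.2 ⟨by linarith, by linarith⟩
  set α := min γ (δ / 2) with hα
  have hα0 : 0 < α := lt_min hγ (by linarith)
  have hαγ : α ≤ γ := min_le_left _ _
  have hαδ : α ≤ δ / 2 := min_le_right _ _
  -- One `r` serves both regimes: `1 - p = 1 / 2 - δ` if `p > 1 / 2`, and `p + α ≤ p + δ / 2 = 1 / 2
  -- - δ / 2` if `p < 1 / 2`. The value `α / 4` is what `pi_not_sparse_le` needs.
  obtain ⟨H, hH⟩ := EdgeMajority.exists_nodeNoiseLaw_newState_le (r := 1 / 2 - δ / 2)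
    (ε := α / 4) (by linarith) (by linarith) (by linarith)
  refine ⟨H, fun G _ hG => ⟨fun hp k hk => ?_, fun hp k hk K hK => ?_⟩⟩
  · rw [abs_of_pos (by linarith)] at hδ
    -- Only one round matters, hence the exponent `K = 0`; the starting configuration is irrelevant,
    -- hence the precondition `True` below.
    refine EdgeMajority.tendsto_measure_one _ _ (EdgeMajority.tendsto_rpow_mul_exp_neg hG
      (fun n => by positivity) le_rfl (half_pos hα0)) ?_
    filter_upwards [EdgeMajority.eventually_minDegree_pos G hG] with n hn
    rw [Real.rpow_zero, one_mul]
    refine le_trans (measureReal_mono ?_) (EdgeMajority.prob_config_succ_le p k (G n)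
      (EdgeMajority.allR n) 0 (fun _ => True) (EdgeMajority.Sparse (G n) EdgeMajority.Opinion.R α)
      (by positivity) fun x _ => EdgeMajority.pi_not_sparse_le (G n) _ x _ hα0.le fun v =>
        hH k hk p n (G n) v x _ ((EdgeMajority.sampleLaw_seenAs_R_le p _ x).trans (by linarith)))
    intro ω hω
    refine ⟨trivial, fun h => hω ?_⟩
    have := EdgeMajority.one_sub_le_volFraction (s' := EdgeMajority.Opinion.B) (by simp) h
      (EdgeMajority.vol_univ_pos hn)
    exact le_trans (by linarith) this
  · rw [abs_of_neg (by linarith)] at hδ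
    refine EdgeMajority.tendsto_measure_one _ _ (EdgeMajority.tendsto_rpow_mul_exp_neg hG
      (fun n => by positivity) hK.le (half_pos hα0)) ?_
    filter_upwards [EdgeMajority.eventually_minDegree_pos G hG] with n hn
    have hT : ((⌊(n : ℝ) ^ K⌋₊ : ℕ) : ℝ) ≤ (n : ℝ) ^ K := Nat.floor_le (by positivity)
    have key := EdgeMajority.prob_exists_not_le p k (G n)
      (EdgeMajority.allR n) ⌊(n : ℝ) ^ K⌋₊ (EdgeMajority.Sparse (G n) EdgeMajority.Opinion.B α)
      (by positivity) (EdgeMajority.sparse_allR (G n) hα0.le) fun x hx =>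
        EdgeMajority.pi_not_sparse_le (G n) _ x _ hα0.le fun v =>
          hH k hk p n (G n) v x _ ((hx.sampleLaw_le p
            (hn.trans_le ((G n).minDegree_le_degree v))).trans (by linarith))
    refine le_trans (measureReal_mono ?_) (key.trans (by gcongr))
    intro ω hω
    simp only [Set.mem_compl_iff, Set.mem_ofPred_eq, not_forall] at hω
    obtain ⟨t, ht, h⟩ := hω
    refine ⟨t, Nat.le_floor ht, fun hs => h ?_⟩
    have := EdgeMajority.one_sub_le_volFraction (s' := EdgeMajority.Opinion.R) (by simp) hs
      (EdgeMajority.vol_univ_pos hn)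
    linarith
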